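/- Let $\mathbf P$ be any set of propositional variables. The language $\mathcal L(\blacktriangle)$ is given by $\phi ::= \top \mid p \mid \neg\phi \mid (\phi\wedge\phi) \mid \blacktriangle\phi$ with $p\in\mathbf P$. It is interpreted in models $\mathcal M=\langle S,R,V\rangle$ with $S\neq\emptyset$, $R\subseteq S\times S$ and $V:\mathbf P\to\mathcal P(S)$, in the usual way for $\top,p,\neg,\wedge$, and by: $\mathcal M,s\vDash\blacktriangle\phi$ iff ($\mathcal M,s\vDash\phi$ implies $\mathcal M,t\vDash\phi$ for all $t$ with $sRt$) and ($\mathcal M,s\nvDash\phi$ implies $\mathcal M,t\nvDash\phi$ for all $t$ with $sRt$). A nonempty relation $Z\subseteq S\times S$ is a $\blacktriangle$-bisimulation on $\mathcal M$ if $sZs'$ implies: (Inv) for all $p\in\mathbf P$, $s\in V(p)$ iff $s'\in V(p)$; (Forth) if $sRt$ and $(s,t)\notin Z$, then there is $t'$ with $s'Rt'$ and $tZt'$; (Back) if $s'Rt'$ and $(s',t')\notin Z$, then there is $t$ with $sRt$ and $tZt'$. Pointed models $(\mathcal M,s)$ and $(\mathcal N,t)$ are $\blacktriangle$-bisimilar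 if there is a $\blacktriangle$-bisimulation $Z$ on the disjoint union of $\mathcal M$ and $\mathcal N$ with $sZt$. Let $\alpha(x)$ be a first-order formula with at most one free variable $x$ in the correspondence language, which has equality, a binary relation symbol for $R$, and a unary predicate symbol for each $p\in\mathbf P$, interpreted in $\mathcal M$ by $V(p)$. Write $\mathcal M,s\vDash\alpha$ if $\alpha$ is true in $\mathcal M$ when $x$ is assigned $s$. Theorem. The following are equivalent: (1) $\alpha$ is equivalent to an $\mathcal L(\blacktriangle)$-formula, i.e. there is $\phi\in\mathcal L(\blacktriangle)$ such that for every pointed model $(\mathcal M,s)$: $\mathcal M,s\vDash\alpha$ iff $\mathcal M,s\vDash\phi$; (2) $\alpha$ is invariant under $\blacktriangle$-bisimulation, i.e. for all pointed models $(\mathcal M,s)$ and $(\mathcal N,t)$ that are $\blacktriangle$-bisimilar: $\mathcal M,s\vDash\alpha$ iff $\mathcal N,t\vDash\alpha$. -/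

import Mathlib

universe u v

namespace StrongNoncontingency

/-- Kripke models over a set `P` of propositional variables: a nonempty set of worlds, an
arbitrary binary accessibility relation, and a valuation. -/
structure KripkeModel (P : Type u) : Type (max u (v + 1)) where
  World : Type v
  nonempty : Nonempty World
  R : World → World → Prop
  V : P → Set World

attribute [instance] KripkeModel.nonempty

/-- The language `L(▲)` of strong noncontingency logic. -/
inductive Formula (P : Type u) : Type u
  | top : Formula P
  | var : P → Formula P
  | neg : Formula P → Formula P
  | and : Formula P → Formula P → Formula P
  | tri : Formula P → Formula P

/-- Truth of an `L(▲)`-formula at a world of a Kripke model. -/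
def Sat {P : Type u} (M : KripkeModel.{u, v} P) (s : M.World) : Formula P → Prop
  | .top => True
  | .var p => s ∈ M.V p
  | .neg φ => ¬ Sat M s φ
  | .and φ ψ => Sat M s φ ∧ Sat M s ψ
  | .tri φ => (Sat M s φ → ∀ t, M.R s t → Sat M t φ) ∧
      (¬ Sat M s φ → ∀ t, M.R s t → ¬ Sat M t φ)

/-- A `▲`-bisimulation on a single model `M`. -/
structure IsTriBisimulation {P : Type u} (M : KripkeModel.{u, v} P)
    (Z : M.World → M.World → Prop) : Prop where
  nonempty : ∃ s s', Z s s'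
  inv : ∀ s s', Z s s' → ∀ p, s ∈ M.V p ↔ s' ∈ M.V p
  forth : ∀ s s', Z s s' → ∀ t, M.R s t → ¬ Z s t → ∃ t', M.R s' t' ∧ Z t t'
  back : ∀ s s', Z s s' → ∀ t', M.R s' t' → ¬ Z s' t' → ∃ t, M.R s t ∧ Z t t'

/-- The disjoint union of two Kripke models. -/
def KripkeModel.disjointUnion {P : Type u} (M N : KripkeModel.{u, v} P) :
    KripkeModel.{u, v} P where
  World := M.World ⊕ N.World
  nonempty := inferInstance
  R := Sum.LiftRel M.R N.R
  V p := Sum.inl '' M.V p ∪ Sum.inr '' N.V p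

/-- Two pointed models are `▲`-bisimilar if their points are linked by a `▲`-bisimulation on the
disjoint union of the two models. -/
def TriBisimilar {P : Type u} (M : KripkeModel.{u, v} P) (s : M.World)
    (N : KripkeModel.{u, v} P) (t : N.World) : Prop :=
  ∃ Z : (M.disjointUnion N).World → (M.disjointUnion N).World → Prop,
    IsTriBisimulation (M.disjointUnion N) Z ∧ Z (Sum.inl s) (Sum.inr t)

/-- Relation symbols of the correspondence language: a unary predicate for every propositional
variable, and one binary relation symbol. -/
inductive CorrRel (P : Type u) : ℕ → Type u
  | pred (p : P) : CorrRel P 1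
  | acc : CorrRel P 2

/-- The first-order correspondence language (equality is a logical symbol). -/
def corrLanguage (P : Type u) : FirstOrder.Language.{0, u} :=
  ⟨fun _ => Empty, CorrRel P⟩

/-- A Kripke model viewed as a first-order structure for the correspondence language. -/
instance KripkeModel.corrStructure {P : Type u} (M : KripkeModel.{u, v} P) :
    (corrLanguage P).Structure M.World where
  funMap f _ := f.elim
  RelMap
    | .pred p, x => x 0 ∈ M.V p
    | .acc, x => M.R (x 0) (x 1)

/-- First-order formulas of the correspondence language with (at most) one free variable. -/
abbrev FOFormula (P : Type u) : Type u :=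
  (corrLanguage P).Formula Unit

/-- Truth of a first-order formula at a pointed model: its free variable is interpreted as the
distinguished world. -/
def FOSat {P : Type u} (M : KripkeModel.{u, v} P) (s : M.World) (α : FOFormula P) : Prop :=
  α.Realize (fun _ => s)

/-- A first-order formula and an `L(▲)`-formula are equivalent if they are true at the same
pointed models. -/
def Equivalent {P : Type u} (α : FOFormula P) (φ : Formula P) : Prop :=
  ∀ (M : KripkeModel.{u, v} P) (s : M.World), FOSat M s α ↔ Sat M s φ

/-- Invariance of a first-order formula under `▲`-bisimulation. -/
def TriInvariant {P : Type u} (α : FOFormula P) : Prop :=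
  ∀ (M : KripkeModel.{u, v} P) (s : M.World) (N : KripkeModel.{u, v} P) (t : N.World),
    TriBisimilar M s N t → (FOSat M s α ↔ FOSat N t α)

end StrongNoncontingency

/-!
An `L(▲)`-formula cannot tell `▲`-bisimilar worlds apart. For the converse, suppose first that
there are only countably many variables, and that an invariant `α` is equivalent to no
`L(▲)`-formula. Compactness gives a world `t` satisfying every `L(▲)`-consequence of `α` but not
`α` itself, and then a world `s` satisfying `α` with the same `L(▲)`-theory as `t`. An
ultraproduct along a nonprincipal ultrafilter on `ℕ` realizes every countable type, so both worlds
may be taken in modally saturated models. There `L(▲)`-equivalence is a `▲`-bisimulation, which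
contradicts invariance. The forth condition only concerns successors `t` of `s` with a different
theory, and this is what makes `▲` as good as `◇`: if `δ` holds at `t` and fails at `s`, then `▲δ`
fails at `s`, and at a world equivalent to `s` this produces a successor satisfying `δ`.

Arbitrary sets of variables reduce to this case because `α` mentions only finitely many of them.
-/

namespace StrongNoncontingency

open Filter FirstOrder Language

universe w

section Semantics

variable {P : Type u}

theorem sat_tri_iff (M : KripkeModel.{u, v} P) (s : M.World) (φ : Formula P) :
    Sat M s φ.tri ↔ ∀ t, M.R s t → (Sat M s φ ↔ Sat M t φ) := by
  simp only [Sat]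
  grind

theorem exists_sat_iff_forall_mem {Δ : Set (Formula P)} (hΔ : Δ.Finite) :
    ∃ δ : Formula P, ∀ (M : KripkeModel.{u, v} P) (s : M.World),
      Sat M s δ ↔ ∀ φ ∈ Δ, Sat M s φ := by
  induction Δ, hΔ using Set.Finite.induction_on with
  | empty => exact ⟨.top, fun M s => by simp [Sat]⟩
  | @insert φ Δ _ _ ih =>
    obtain ⟨δ, hδ⟩ := ih
    exact ⟨φ.and δ, fun M s => by simp [Sat, hδ]⟩

/-- `L(▲)`-equivalence of pointed models: they satisfy the same `L(▲)`-formulas. -/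
def TriEquiv (M : KripkeModel.{u, v} P) (s : M.World) (N : KripkeModel.{u, v} P)
    (t : N.World) : Prop :=
  ∀ φ, Sat M s φ ↔ Sat N t φ

theorem TriEquiv.symm {M N : KripkeModel.{u, v} P} {s : M.World} {t : N.World}
    (h : TriEquiv M s N t) : TriEquiv N t M s :=
  fun φ => (h φ).symm

theorem triEquiv_of_forall_sat_imp {M N : KripkeModel.{u, v} P} {s : M.World} {t : N.World}
    (h : ∀ φ, Sat M s φ → Sat N t φ) : TriEquiv M s N t :=
  fun φ => ⟨h φ, fun ht => by_contra fun hs => h φ.neg hs ht⟩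

theorem IsTriBisimulation.triEquiv {M : KripkeModel.{u, v} P} {Z : M.World → M.World → Prop}
    (hZ : IsTriBisimulation M Z) {s s' : M.World} (h : Z s s') : TriEquiv M s M s' := by
  intro φ
  induction φ generalizing s s' with
  | top => exact Iff.rfl
  | var p => exact hZ.inv s s' h p
  | neg φ ih => exact not_congr (ih h)
  | and φ ψ ihφ ihψ => exact and_congr (ihφ h) (ihψ h)
  | tri φ ih =>
    rw [sat_tri_iff, sat_tri_iff]
    constructor
    · intro hs t' ht'
      by_cases hz : Z s' t'
      · exact ih hz
      · obtain ⟨t, ht, htt'⟩ := hZ.back s s' h t' ht' hz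
        exact (ih h).symm.trans ((hs t ht).trans (ih htt'))
    · intro hs' t ht
      by_cases hz : Z s t
      · exact ih hz
      · obtain ⟨t', ht', htt'⟩ := hZ.forth s s' h t ht hz
        exact (ih h).trans ((hs' t' ht').trans (ih htt').symm)

end Semantics

section Countability

variable {P : Type u}

/-- Arities of the connectives of `L(▲)`, for presenting formulas as well-founded trees: `⊤` and the
variables are `Sum.inl none` and `Sum.inl (some p)`, the negation and `▲` are the two unary
connectives `Sum.inr (Sum.inl _)`, and the conjunction is `Sum.inr (Sum.inr _)`. -/
def Formula.Arity : Option P ⊕ Bool ⊕ Unit → Type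
  | .inl _ => Empty
  | .inr (.inl _) => Unit
  | .inr (.inr _) => Bool

instance (c : Option P ⊕ Bool ⊕ Unit) : Finite (Formula.Arity c) := by
  rcases c with _ | _ | _ <;> unfold Formula.Arity <;> infer_instance

/-- The formula presented by a well-founded tree of connectives. -/
def Formula.ofWType : WType (Formula.Arity (P := P)) → Formula P :=
  WType.elim (Formula P) fun
    | ⟨.inl none, _⟩ => .top
    | ⟨.inl (some p), _⟩ => .var p
    | ⟨.inr (.inl false), φ⟩ => .neg (φ ())
    | ⟨.inr (.inl true), φ⟩ => .tri (φ ())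
    | ⟨.inr (.inr ()), φ⟩ => .and (φ false) (φ true)

theorem Formula.ofWType_surjective : Function.Surjective (Formula.ofWType (P := P)) := by
  intro φ
  induction φ with
  | top => exact ⟨⟨.inl none, Empty.elim⟩, rfl⟩
  | var p => exact ⟨⟨.inl (some p), Empty.elim⟩, rfl⟩
  | neg φ ih =>
    obtain ⟨w, rfl⟩ := ih
    exact ⟨⟨.inr (.inl false), fun _ => w⟩, rfl⟩
  | and φ ψ ihφ ihψ =>
    obtain ⟨w, rfl⟩ := ihφ
    obtain ⟨w', rfl⟩ := ihψ
    exact ⟨⟨.inr (.inr ()), fun b : Bool => cond b w' w⟩, rfl⟩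
  | tri φ ih =>
    obtain ⟨w, rfl⟩ := ih
    exact ⟨⟨.inr (.inl true), fun _ => w⟩, rfl⟩

instance [Countable P] : Countable (Formula P) := by
  have : Countable (WType (Formula.Arity (P := P))) := by
    rw [← Cardinal.mk_le_aleph0_iff]
    refine WType.cardinalMk_le_max_aleph0_of_finite'.trans ?_
    simp
  exact Formula.ofWType_surjective.countable

end Countability

section BoundedMorphisms

variable {P : Type u} {M N : KripkeModel.{u, v} P}

/-- Bounded morphisms of Kripke models, the functional bisimulations. Both inclusions into a
disjoint union are of this kind. -/
structure IsBoundedMorphism (M N : KripkeModel.{u, v} P) (f : M.World → N.World) : Prop where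
  mem_V_iff : ∀ s p, f s ∈ N.V p ↔ s ∈ M.V p
  R_iff : ∀ s u, N.R (f s) u ↔ ∃ t, M.R s t ∧ f t = u

theorem isBoundedMorphism_inl : IsBoundedMorphism M (M.disjointUnion N) Sum.inl where
  mem_V_iff s p := by
    change _ ∈ Sum.inl '' M.V p ∪ Sum.inr '' N.V p ↔ _
    simp
  R_iff s u := by cases u <;> simp [KripkeModel.disjointUnion]

theorem isBoundedMorphism_inr : IsBoundedMorphism N (M.disjointUnion N) Sum.inr where
  mem_V_iff s p := by
    change _ ∈ Sum.inl '' M.V p ∪ Sum.inr '' N.V p ↔ _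
    simp
  R_iff s u := by cases u <;> simp [KripkeModel.disjointUnion]

theorem IsBoundedMorphism.triEquiv {f : M.World → N.World} (hf : IsBoundedMorphism M N f)
    (s : M.World) : TriEquiv N (f s) M s := by
  intro φ
  induction φ generalizing s with
  | top => exact Iff.rfl
  | var p => exact hf.mem_V_iff s p
  | neg φ ih => exact not_congr (ih s)
  | and φ ψ ihφ ihψ => exact and_congr (ihφ s) (ihψ s)
  | tri φ ih => simp only [sat_tri_iff, hf.R_iff, forall_exists_index, and_imp,
      forall_apply_eq_imp_iff₂, ih]

theorem IsBoundedMorphism.exists_R_and_sat_iff {f : M.World → N.World}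
    (hf : IsBoundedMorphism M N f) {s : M.World} {Γ : Set (Formula P)} :
    (∃ u, N.R (f s) u ∧ ∀ φ ∈ Γ, Sat N u φ) ↔ ∃ t, M.R s t ∧ ∀ φ ∈ Γ, Sat M t φ := by
  simp only [hf.R_iff, ← hf.triEquiv _ _]
  grind

theorem TriBisimilar.triEquiv {s : M.World} {t : N.World} (h : TriBisimilar M s N t) :
    TriEquiv M s N t := by
  obtain ⟨Z, hZ, hst⟩ := h
  exact fun φ => (isBoundedMorphism_inl.triEquiv s φ).symm.trans
    ((hZ.triEquiv hst φ).trans (isBoundedMorphism_inr.triEquiv t φ))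

theorem Equivalent.triInvariant {α : FOFormula P} {φ : Formula P}
    (h : Equivalent.{u, v} α φ) : TriInvariant.{u, v} α :=
  fun M s N t hst => (h M s).trans ((hst.triEquiv φ).trans (h N t).symm)

end BoundedMorphisms

section Saturation

variable {P : Type u} {M N : KripkeModel.{u, v} P}

/-- Modally saturated models (m-saturated in the literature): a set of formulas that is finitely
satisfiable among the successors of a world is satisfied at one of them. -/
def IsModallySaturated (M : KripkeModel.{u, v} P) : Prop :=
  ∀ (s : M.World) (Γ : Set (Formula P)),
    (∀ Δ ⊆ Γ, Δ.Finite → ∃ t, M.R s t ∧ ∀ φ ∈ Δ, Sat M t φ) →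
      ∃ t, M.R s t ∧ ∀ φ ∈ Γ, Sat M t φ

theorem IsModallySaturated.disjointUnion (hM : IsModallySaturated M)
    (hN : IsModallySaturated N) : IsModallySaturated (M.disjointUnion N) := by
  rintro (s | s) Γ
  · simp only [isBoundedMorphism_inl.exists_R_and_sat_iff]
    exact hM s Γ
  · simp only [isBoundedMorphism_inr.exists_R_and_sat_iff]
    exact hN s Γ

theorem TriEquiv.exists_R_and_sat {s s' t : M.World} {δ : Formula P} (hss' : TriEquiv M s M s')
    (hst : M.R s t) (hs : ¬ Sat M s δ) (ht : Sat M t δ) : ∃ t', M.R s' t' ∧ Sat M t' δ := by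
  have hs'_tri : ¬ Sat M s' δ.tri := by
    rw [← hss', sat_tri_iff]
    exact fun h => hs ((h t hst).2 ht)
  have hs' : ¬ Sat M s' δ := fun h => hs ((hss' δ).2 h)
  simpa [sat_tri_iff, hs'] using hs'_tri

theorem IsModallySaturated.exists_R_and_triEquiv (hM : IsModallySaturated M) {s s' t : M.World}
    (hss' : TriEquiv M s M s') (hst : M.R s t) (hne : ¬ TriEquiv M s M t) :
    ∃ t', M.R s' t' ∧ TriEquiv M t M t' := by
  obtain ⟨χ, htχ, hsχ⟩ : ∃ χ, Sat M t χ ∧ ¬ Sat M s χ := by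
    by_contra! h
    exact hne (triEquiv_of_forall_sat_imp h).symm
  obtain ⟨t', ht', hsat⟩ := hM s' {φ | Sat M t φ} fun Δ hΔt hΔ => by
    obtain ⟨δ, hδ⟩ := exists_sat_iff_forall_mem.{u, v} hΔ
    obtain ⟨t', ht', hχδ⟩ := hss'.exists_R_and_sat (δ := χ.and δ) hst (fun h => hsχ h.1)
      ⟨htχ, (hδ M t).2 fun φ hφ => hΔt hφ⟩
    exact ⟨t', ht', (hδ M t').1 hχδ.2⟩
  exact ⟨t', ht', triEquiv_of_forall_sat_imp hsat⟩

theorem IsModallySaturated.isTriBisimulation_triEquiv (hM : IsModallySaturated M) :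
    IsTriBisimulation M fun s t => TriEquiv M s M t where
  nonempty := ⟨Classical.arbitrary _, Classical.arbitrary _, fun _ => Iff.rfl⟩
  inv _ _ h p := h (.var p)
  forth _ _ h _ := hM.exists_R_and_triEquiv h
  back _ _ h _ ht' hne := by
    obtain ⟨t, ht, htt'⟩ := hM.exists_R_and_triEquiv h.symm ht' hne
    exact ⟨t, ht, htt'.symm⟩

theorem TriEquiv.triBisimilar {s : M.World} {t : N.World} (h : TriEquiv M s N t)
    (hM : IsModallySaturated M) (hN : IsModallySaturated N) : TriBisimilar M s N t :=
  ⟨_, (hM.disjointUnion hN).isTriBisimulation_triEquiv, fun φ =>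
    (isBoundedMorphism_inl.triEquiv s φ).trans
      ((h φ).trans (isBoundedMorphism_inr.triEquiv t φ).symm)⟩

end Saturation

section StandardTranslation

variable {P : Type u}

/-- The unary predicate symbol of `p`, as a relation symbol of `corrLanguage P`. -/
def predSymbol (p : P) : (corrLanguage P).Relations 1 :=
  CorrRel.pred p

/-- The accessibility symbol, as a relation symbol of `corrLanguage P`. -/
def accSymbol : (corrLanguage P).Relations 2 :=
  CorrRel.acc

theorem relMap_predSymbol (M : KripkeModel.{u, v} P) (p : P) (s : M.World) :
    Structure.RelMap (predSymbol p) ![s] ↔ s ∈ M.V p :=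
  Iff.rfl

theorem relMap_accSymbol (M : KripkeModel.{u, v} P) (s t : M.World) :
    Structure.RelMap (accSymbol (P := P)) ![s, t] ↔ M.R s t :=
  Iff.rfl

/-- The standard translation of `L(▲)` into the correspondence language, relative to the variable
`x` standing for the current world. The successor quantified by `▲` is the next bound variable. -/
def Formula.standardTranslation : Formula P → {n : ℕ} → Unit ⊕ Fin n →
    (corrLanguage P).BoundedFormula Unit n
  | .top, _, _ => ⊤
  | .var p, _, x => (predSymbol p).boundedFormula₁ (.var x)
  | .neg φ, _, x => ∼(φ.standardTranslation x)
  | .and φ ψ, _, x => φ.standardTranslation x ⊓ ψ.standardTranslation x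
  | .tri φ, n, x =>
    ∀' ((accSymbol.boundedFormula₂
        (.var (x.map id Fin.castSucc)) (.var (.inr (Fin.last n)))).imp
      ((φ.standardTranslation (x.map id Fin.castSucc)).iff
        (φ.standardTranslation (.inr (Fin.last n)))))

theorem realize_standardTranslation (M : KripkeModel.{u, v} P) (φ : Formula P) {n : ℕ}
    (x : Unit ⊕ Fin n) (w : Unit → M.World) (ws : Fin n → M.World) :
    (φ.standardTranslation x).Realize w ws ↔ Sat M (Sum.elim w ws x) φ := by
  induction φ generalizing n with
  | top => simp [Formula.standardTranslation, Sat]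
  | var p =>
    simp [Formula.standardTranslation, BoundedFormula.realize_rel₁, relMap_predSymbol, Sat]
  | neg φ ih => simp [Formula.standardTranslation, Sat, ih]
  | and φ ψ ihφ ihψ => simp [Formula.standardTranslation, Sat, ihφ, ihψ]
  | tri φ ih =>
    have elim_snoc (t : M.World) :
        Sum.elim w (Fin.snoc ws t : Fin (n + 1) → M.World) (x.map id Fin.castSucc) =
          Sum.elim w ws x := by
      cases x <;> simp
    simp only [Formula.standardTranslation, BoundedFormula.realize_all, BoundedFormula.realize_imp,
      BoundedFormula.realize_iff, BoundedFormula.realize_rel₂, Term.realize_var, ih, elim_snoc,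
      Sum.elim_inr, Fin.snoc_last, relMap_accSymbol, sat_tri_iff]

theorem equivalent_standardTranslation (φ : Formula P) :
    Equivalent.{u, v} (φ.standardTranslation (n := 0) (.inl ())) φ :=
  fun M s => realize_standardTranslation M φ (.inl ()) (fun _ => s) default

end StandardTranslation

section Ultraproducts

variable {P : Type u} {ι : Type w} {𝒰 : Ultrafilter ι} {M : ι → KripkeModel.{u, v} P}

/-- A nonempty first-order structure for the correspondence language, viewed as a Kripke model. -/
def KripkeModel.ofStructure (W : Type v) [Nonempty W] [(corrLanguage P).Structure W] :
    KripkeModel.{u, v} P where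
  World := W
  nonempty := inferInstance
  R x y := Structure.RelMap (accSymbol (P := P)) ![x, y]
  V p := {x | Structure.RelMap (predSymbol p) ![x]}

theorem corrStructure_ofStructure (W : Type v) [Nonempty W] [S : (corrLanguage P).Structure W] :
    (KripkeModel.ofStructure W).corrStructure = S := by
  refine Structure.ext ?_ ?_
  · funext n f
    exact f.elim
  · funext n r x
    cases r with
    | pred p => exact congrArg (S.RelMap (CorrRel.pred p)) (List.ofFn_injective rfl)
    | acc => exact congrArg (S.RelMap CorrRel.acc) (List.ofFn_injective rfl)

/-- The ultraproduct of a family of Kripke models. -/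
def KripkeModel.ultraproduct (𝒰 : Ultrafilter ι) (M : ι → KripkeModel.{u, v} P) :
    KripkeModel.{u, max w v} P :=
  .ofStructure ((𝒰 : Filter ι).Product fun i => (M i).World)

/-- The world of the ultraproduct represented by a choice of a world in each factor. -/
def KripkeModel.ultraMk (𝒰 : Ultrafilter ι) {M : ι → KripkeModel.{u, v} P}
    (f : ∀ i, (M i).World) : (KripkeModel.ultraproduct 𝒰 M).World :=
  Quotient.mk ((𝒰 : Filter ι).productSetoid fun i => (M i).World) f

open KripkeModel (ultraproduct ultraMk)

theorem ultraproduct_R_ultraMk (f g : ∀ i, (M i).World) :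
    (ultraproduct 𝒰 M).R (ultraMk 𝒰 f) (ultraMk 𝒰 g) ↔ ∀ᶠ i in 𝒰, (M i).R (f i) (g i) := by
  have h := Ultraproduct.realize_formula_cast (L := corrLanguage P) (u := 𝒰)
    (M := fun i => (M i).World) (accSymbol.formula₂ (.var 0) (.var 1)) ![f, g]
  simp only [Formula.realize_rel₂] at h
  exact h

theorem foSat_ultraMk (f : ∀ i, (M i).World) (α : FOFormula P) :
    FOSat (ultraproduct 𝒰 M) (ultraMk 𝒰 f) α ↔ ∀ᶠ i in 𝒰, FOSat (M i) (f i) α := by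
  have h := Ultraproduct.realize_formula_cast (L := corrLanguage P) (u := 𝒰)
    (M := fun i => (M i).World) α fun _ => f
  unfold FOSat ultraproduct
  rw [corrStructure_ofStructure]
  exact h

theorem sat_ultraMk (f : ∀ i, (M i).World) (φ : Formula P) :
    Sat (ultraproduct 𝒰 M) (ultraMk 𝒰 f) φ ↔ ∀ᶠ i in 𝒰, Sat (M i) (f i) φ := by
  simp only [← equivalent_standardTranslation φ _ _, foSat_ultraMk]

/-- The reason why ultraproducts along countably incomplete ultrafilters are saturated: at the index
`i`, satisfy an initial segment of the conditions that is as long as possible up to `r i`. -/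
theorem exists_forall_eventually_of_finite {l : Filter ι} {r : ι → ℕ} (hr : Tendsto r l atTop)
    {κ : Type*} [Countable κ] {W : ι → Type*} [∀ i, Nonempty (W i)] {p : κ → ∀ i, W i → Prop}
    (h : ∀ s : Set κ, s.Finite → ∀ᶠ i in l, ∃ w, ∀ k ∈ s, p k i w) :
    ∃ g : ∀ i, W i, ∀ k, ∀ᶠ i in l, p k i (g i) := by
  classical
  obtain ⟨code, hcode⟩ := exists_injective_nat κ
  let Meets (i : ι) (n : ℕ) : Prop := ∃ w, ∀ k, code k < n → p k i w
  have meets_greatest (i : ι) : Meets i (Nat.findGreatest (Meets i) (r i)) :=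
    Nat.findGreatest_spec (Nat.zero_le _) ⟨Classical.arbitrary _, by simp⟩
  have eventually_meets (n : ℕ) : ∀ᶠ i in l, Meets i n :=
    h {k | code k < n} ((Set.finite_Iio n).preimage hcode.injOn)
  choose g hg using meets_greatest
  refine ⟨g, fun k => ?_⟩
  filter_upwards [hr.eventually_ge_atTop (code k + 1), eventually_meets (code k + 1)] with i hi hk
  exact hg i k (Nat.le_findGreatest hi hk)

theorem isModallySaturated_ultraproduct [Countable P] {r : ι → ℕ} (hr : Tendsto r 𝒰 atTop) :
    IsModallySaturated (ultraproduct 𝒰 M) := by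
  intro s Γ hΓ
  obtain ⟨f, rfl⟩ := Quotient.exists_rep s
  obtain ⟨g, hg⟩ := exists_forall_eventually_of_finite hr
    (p := fun φ i t => (M i).R (f i) t ∧ (φ ∈ Γ → Sat (M i) t φ)) fun Δ hΔ => by
      obtain ⟨t, hst, ht⟩ := hΓ (Δ ∩ Γ) Set.inter_subset_right (hΔ.inter_of_left Γ)
      obtain ⟨g, rfl⟩ := Quotient.exists_rep t
      have hR : ∀ᶠ i in 𝒰, (M i).R (f i) (g i) := (ultraproduct_R_ultraMk f g).1 hst
      have hSat : ∀ᶠ i in 𝒰, ∀ φ ∈ Δ ∩ Γ, Sat (M i) (g i) φ :=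
        (eventually_all_finite (hΔ.inter_of_left Γ)).2 fun φ hφ => (sat_ultraMk g φ).1 (ht φ hφ)
      filter_upwards [hR, hSat] with i hRi hi
      exact ⟨g i, fun φ hφ => ⟨hRi, fun hφΓ => hi φ ⟨hφ, hφΓ⟩⟩⟩
  exact ⟨ultraMk 𝒰 g, (ultraproduct_R_ultraMk f g).2 ((hg .top).mono fun _ h => h.1),
    fun φ hφ => (sat_ultraMk g φ).2 ((hg φ).mono fun _ h => h.2 hφ)⟩

theorem exists_isModallySaturated_of_finitely_satisfiable [Countable P] {α : FOFormula P}
    {Γ : Set (Formula P)}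
    (h : ∀ Δ ⊆ Γ, Δ.Finite → ∃ (M : KripkeModel.{u, v} P) (s : M.World),
      FOSat M s α ∧ ∀ φ ∈ Δ, Sat M s φ) :
    ∃ (M : KripkeModel.{u, v} P) (s : M.World), IsModallySaturated M ∧
      FOSat M s α ∧ ∀ φ ∈ Γ, Sat M s φ := by
  let Pointed := {x : Σ M : KripkeModel.{u, v} P, M.World // FOSat x.1 x.2 α}
  have satisfiable (Δ : Set (Formula P)) (hΔ : Δ.Finite) :
      ∃ x : Pointed, ∀ φ ∈ Δ, φ ∈ Γ → Sat x.1.1 x.1.2 φ := by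
    obtain ⟨M, s, hα, hs⟩ := h (Δ ∩ Γ) Set.inter_subset_right (hΔ.inter_of_left Γ)
    exact ⟨⟨⟨M, s⟩, hα⟩, fun φ hφ hφΓ => hs φ ⟨hφ, hφΓ⟩⟩
  have : Nonempty Pointed := (satisfiable ∅ Set.finite_empty).nonempty
  have hr : Tendsto id (hyperfilter ℕ : Filter ℕ) atTop := Nat.hyperfilter_le_atTop
  obtain ⟨x, hx⟩ := exists_forall_eventually_of_finite hr (W := fun _ => Pointed)
    fun Δ hΔ => Eventually.of_forall fun _ => satisfiable Δ hΔ
  exact ⟨ultraproduct (hyperfilter ℕ) fun n => (x n).1.1, ultraMk _ fun n => (x n).1.2,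
    isModallySaturated_ultraproduct hr,
    (foSat_ultraMk _ α).2 (Eventually.of_forall fun n => (x n).2),
    fun φ hφ => (sat_ultraMk _ φ).2 ((hx φ).mono fun _ h => h hφ)⟩

end Ultraproducts

section Definability

variable {P : Type u}

theorem TriInvariant.exists_equivalent_of_countable [Countable P] {α : FOFormula P}
    (hα : TriInvariant.{u, v} α) : ∃ φ, Equivalent.{u, v} α φ := by
  by_contra! hno
  obtain ⟨N, t, hN, htα, ht⟩ := exists_isModallySaturated_of_finitely_satisfiable (α := α.not)
    (Γ := {φ | ∀ (M : KripkeModel.{u, v} P) s, FOSat M s α → Sat M s φ}) fun Δ hΔα hΔ => by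
      obtain ⟨δ, hδ⟩ := exists_sat_iff_forall_mem.{u, v} hΔ
      by_contra! hΔ'
      refine hno δ fun M s => ⟨fun hs => (hδ M s).2 fun φ hφ => hΔα hφ M s hs, fun hs => ?_⟩
      by_contra hsα
      obtain ⟨φ, hφ, hsφ⟩ := hΔ' M s hsα
      exact hsφ ((hδ M s).1 hs φ hφ)
  obtain ⟨M, s, hM, hsα, hs⟩ := exists_isModallySaturated_of_finitely_satisfiable (α := α)
    (Γ := {φ | Sat N t φ}) fun Δ hΔt hΔ => by
      obtain ⟨δ, hδ⟩ := exists_sat_iff_forall_mem.{u, v} hΔ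
      by_contra! hΔ'
      refine ht δ.neg (fun M s hs hsδ => ?_) ((hδ N t).2 fun φ hφ => hΔt hφ)
      obtain ⟨φ, hφ, hsφ⟩ := hΔ' M s hs
      exact hsφ ((hδ M s).1 hsδ φ hφ)
  have hst : TriEquiv M s N t := (triEquiv_of_forall_sat_imp hs).symm
  exact htα ((hα M s N t (hst.triBisimilar hM hN)).1 hsα)

end Definability

section Renaming

variable {P : Type u} {Q : Type u}

/-- Renaming of the propositional variables of an `L(▲)`-formula. -/
def Formula.map (f : Q → P) : Formula Q → Formula P
  | .top => .top
  | .var q => .var (f q)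
  | .neg φ => .neg (φ.map f)
  | .and φ ψ => .and (φ.map f) (ψ.map f)
  | .tri φ => .tri (φ.map f)

/-- The renaming of predicate symbols induced by a renaming of propositional variables. -/
def corrLHom (f : Q → P) : corrLanguage Q →ᴸ corrLanguage P where
  onFunction _ g := g.elim
  onRelation
    | _, .pred q => .pred (f q)
    | _, .acc => .acc

/-- The reduct of a Kripke model along a renaming `f`: the variable `q` is read as `f q`. -/
def KripkeModel.reduct (f : Q → P) (M : KripkeModel.{u, v} P) : KripkeModel.{u, v} Q where
  World := M.World
  nonempty := M.nonempty
  R := M.R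
  V q := M.V (f q)

theorem sat_map (f : Q → P) (M : KripkeModel.{u, v} P) (s : M.World) (φ : Formula Q) :
    Sat M s (φ.map f) ↔ Sat (M.reduct f) s φ := by
  induction φ generalizing s with
  | top => exact Iff.rfl
  | var q => exact Iff.rfl
  | neg φ ih => exact not_congr (ih s)
  | and φ ψ ihφ ihψ => exact and_congr (ihφ s) (ihψ s)
  | tri φ ih =>
    calc Sat M s (φ.map f).tri
        ↔ ∀ t, M.R s t → (Sat M s (φ.map f) ↔ Sat M t (φ.map f)) := sat_tri_iff M s (φ.map f)
      _ ↔ ∀ t, M.R s t → (Sat (M.reduct f) s φ ↔ Sat (M.reduct f) t φ) := by simp only [ih]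
      _ ↔ Sat (M.reduct f) s φ.tri := (sat_tri_iff (M.reduct f) s φ).symm

theorem foSat_onFormula_corrLHom (f : Q → P) (M : KripkeModel.{u, v} P) (s : M.World)
    (α : FOFormula Q) :
    FOSat M s ((corrLHom f).onFormula α) ↔ FOSat (M.reduct f) s α := by
  let : (corrLanguage Q).Structure M.World := (M.reduct f).corrStructure
  have : (corrLHom f).IsExpansionOn M.World :=
    { map_onFunction := fun g => g.elim
      map_onRelation := fun R _ => by cases R <;> exact rfl }
  exact (corrLHom f).realize_onFormula α

theorem TriBisimilar.reduct (f : Q → P) {M N : KripkeModel.{u, v} P} {s : M.World} {t : N.World}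
    (h : TriBisimilar M s N t) : TriBisimilar (M.reduct f) s (N.reduct f) t := by
  obtain ⟨Z, hZ, hst⟩ := h
  exact ⟨Z, ⟨hZ.nonempty, fun x y hxy q => hZ.inv x y hxy (f q), hZ.forth, hZ.back⟩, hst⟩

theorem TriInvariant.onFormula_corrLHom {α : FOFormula Q} (hα : TriInvariant.{u, v} α)
    (f : Q → P) : TriInvariant.{u, v} ((corrLHom f).onFormula α) := by
  intro M s N t hst
  simp only [foSat_onFormula_corrLHom]
  exact hα (M.reduct f) s (N.reduct f) t (hst.reduct f)

theorem exists_finset_onBoundedFormula_eq {β : Type*} {n : ℕ}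
    (α : (corrLanguage P).BoundedFormula β n) :
    ∃ F : Finset P, ∀ r : P → P, Set.EqOn r id F → (corrLHom r).onBoundedFormula α = α := by
  classical
  have onTerm_eq (r : P → P) {γ : Type _} (t : (corrLanguage P).Term γ) :
      (corrLHom r).onTerm t = t := by
    cases t with
    | var => rfl
    | func g => exact g.elim
  induction α with
  | falsum => exact ⟨∅, fun _ _ => rfl⟩
  | equal t₁ t₂ => exact ⟨∅, fun r _ => congrArg₂ _ (onTerm_eq r t₁) (onTerm_eq r t₂)⟩
  | rel R ts =>
    have rel_eq (r : P → P) (hR : (corrLHom r).onRelation R = R) :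
        (corrLHom r).onBoundedFormula (.rel R ts) = .rel R ts :=
      congrArg₂ _ hR (funext fun i => onTerm_eq r (ts i))
    cases R with
    | pred p => exact ⟨{p}, fun r hr => rel_eq r (congrArg CorrRel.pred (hr (by simp)))⟩
    | acc => exact ⟨∅, fun r _ => rel_eq r rfl⟩
  | imp α₁ α₂ ih₁ ih₂ =>
    obtain ⟨F₁, h₁⟩ := ih₁
    obtain ⟨F₂, h₂⟩ := ih₂
    refine ⟨F₁ ∪ F₂, fun r hr => ?_⟩
    rw [Finset.coe_union, Set.eqOn_union] at hr
    exact congrArg₂ _ (h₁ r hr.1) (h₂ r hr.2)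
  | all α ih =>
    obtain ⟨F, h⟩ := ih
    exact ⟨F, fun r hr => congrArg _ (h r hr)⟩

theorem exists_countable_onFormula_eq (α : FOFormula P) :
    ∃ (Q : Type u) (i : Q → P) (r : P → Q), Countable Q ∧
      (corrLHom (i ∘ r)).onFormula α = α := by
  classical
  obtain ⟨F, hF⟩ := exists_finset_onBoundedFormula_eq α
  rcases isEmpty_or_nonempty P with hP | ⟨⟨p⟩⟩
  · exact ⟨P, id, id, inferInstance, hF _ fun _ _ => rfl⟩
  · let i : {q // q ∈ insert p F} → P := Subtype.val
    have : Nonempty {q // q ∈ insert p F} := ⟨⟨p, Finset.mem_insert_self p F⟩⟩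
    exact ⟨_, i, Function.invFun i, inferInstance, hF _ fun q hq =>
      Function.invFun_eq ⟨⟨q, Finset.mem_insert_of_mem hq⟩, rfl⟩⟩

end Renaming

theorem TriInvariant.exists_equivalent {P : Type u} {α : FOFormula P}
    (hα : TriInvariant.{u, v} α) : ∃ φ, Equivalent.{u, v} α φ := by
  obtain ⟨Q, i, r, hQ, hir⟩ := exists_countable_onFormula_eq α
  obtain ⟨φ, hφ⟩ := (hα.onFormula_corrLHom r).exists_equivalent_of_countable
  refine ⟨φ.map i, fun M s => ?_⟩
  calc FOSat M s α
      ↔ FOSat (M.reduct (i ∘ r)) s α := by rw [← foSat_onFormula_corrLHom, hir]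
    _ ↔ FOSat (M.reduct i) s ((corrLHom r).onFormula α) :=
        (foSat_onFormula_corrLHom r (M.reduct i) s α).symm
    _ ↔ Sat (M.reduct i) s φ := hφ (M.reduct i) s
    _ ↔ Sat M s (φ.map i) := (sat_map i M s φ).symm

end StrongNoncontingency

theorem mainTheorem3_general {P : Type u} (α : StrongNoncontingency.FOFormula P) :
    (∃ φ : StrongNoncontingency.Formula P, StrongNoncontingency.Equivalent.{u, v} α φ) ↔
      StrongNoncontingency.TriInvariant.{u, v} α :=
  ⟨fun ⟨_, hφ⟩ => hφ.triInvariant, fun hα => hα.exists_equivalent⟩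

theorem mainTheorem3 {P : Type u} (α : StrongNoncontingency.FOFormula P) :
    (∃ φ : StrongNoncontingency.Formula P,
        StrongNoncontingency.Equivalent.{u, max u v} α φ) ↔
      StrongNoncontingency.TriInvariant.{u, max u v} α :=
  mainTheorem3_general α
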